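/- Let $n \ge 0$ and let $S_n$ be the symmetric group on $\{1,\dots,n\}$. For $\pi \in S_n$ let $\mathrm{des}(\pi)$ be the number of descents of $\pi$, that is, the number of $i \in \{1,\dots,n-1\}$ with $\pi(i) > \pi(i+1)$. Let $C$ be a conjugacy class of $S_n$ and let $M := \max_{\pi \in C} \mathrm{des}(\pi)$. If $C \ne \{e\}$, then $$\{\mathrm{des}(\pi) : \pi \in C\} = \{1, \dots, M\}.$$ If $C = \{e\}$, then $\{\mathrm{des}(\pi) : \pi \in C\} = \{0\}$. -/

import Mathlib

/-- The set of descents of a permutation `π` of an `n`-element chain. With positions counted from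
`0`, a position `i` is a descent if it is not the last one and `π i > π (i + 1)`. -/
def descentSet {n : ℕ} (π : Equiv.Perm (Fin n)) : Finset (Fin n) :=
  {i : Fin n | ∃ h : (i : ℕ) + 1 < n, π ⟨(i : ℕ) + 1, h⟩ < π i}

/-- The number of descents of a permutation. -/
def des {n : ℕ} (π : Equiv.Perm (Fin n)) : ℕ :=
  (descentSet π).card

/-! Conjugating `π` by `e` amounts to reading `π` in the linear order `e`: the descents of `e * π *
e⁻¹` are the pairs of `e`-neighbours whose order `π` reverses. For `π ≠ 1` there is always at least
one, and a suitable order has exactly one (`exists_orderDes_eq_one`). What remains is that no value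
in between is skipped (`exists_orderDes_eq`).

Orders are connected by exchanges of neighbours, and each exchange changes the count by at most 2. A
skipped value `k` is therefore jumped over, between `k - 1` and `k + 1`, when some neighbours `a`,
`b` are exchanged. Such a jump forces the preimages of `a` and `b` to be neighbours too. Exchanging
other pairs of the backward orbit would produce `k`, unless all iterated preimages of `{a, b}` are
adjacent pairs (`IsJump.adjacent_iterate`); these are then equal or disjoint.

Now collapse each pair of the orbit to a point. The count is that of the quotient permutation plus
the descents inside pairs (`orderDes_eq_add_fiberDes`), and the two summands can be prescribed
independently (`exists_compatible`). The jump changes only the second summand, by 2, so if the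
quotient count is `d`, no order of the quotient has count `d + 1` or `d - 1`. By induction on `n`
the quotient only has the value 1, hence at most three points (`exists_two_le_orderDes`). So `π`
acts on four or six points, where explicit conjugates attain `k`. -/

open Equiv

/-- The descents of the word `f` read along the order `e`: the elements `x` whose
`e`-successor `y` satisfies `f y < f x`. -/
def relDescents {n : ℕ} (e f : Perm (Fin n)) : Finset (Fin n) :=
  {x : Fin n | ∃ y, (e y : ℕ) = e x + 1 ∧ f y < f x}

/-- The number of descents of the word `f` read along the order `e`. -/
def relDes {n : ℕ} (e f : Perm (Fin n)) : ℕ := (relDescents e f).card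

/-- The number of descents of `π` with respect to the order `e`. -/
def orderDes {n : ℕ} (π e : Perm (Fin n)) : ℕ := relDes e (e * π)

/-- `x` and `y` are neighbours in the order `e`. -/
def Adjacent {n : ℕ} (e : Perm (Fin n)) (x y : Fin n) : Prop :=
  (e y : ℕ) = e x + 1 ∨ (e x : ℕ) = e y + 1

instance {n : ℕ} (e : Perm (Fin n)) (x y : Fin n) : Decidable (Adjacent e x y) :=
  inferInstanceAs (Decidable (_ ∨ _))

/-- `1` if `e` and `f` order `x` and `y` in the same way, and `-1` otherwise. -/
def orderSign {n : ℕ} (e f : Perm (Fin n)) (x y : Fin n) : ℤ :=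
  if (e x < e y ↔ f x < f y) then 1 else -1

/-! ### Descents along an order, and the effect of one exchange -/

section Basic

variable {n : ℕ} {e f π : Perm (Fin n)} {x y a b p q : Fin n}

theorem val_eq_iff (e : Perm (Fin n)) (x y : Fin n) : (e x : ℕ) = e y ↔ x = y := by
  rw [Fin.val_inj, e.injective.eq_iff]

theorem Adjacent.symm (h : Adjacent e x y) : Adjacent e y x := Or.symm h

theorem adjacent_comm : Adjacent e x y ↔ Adjacent e y x := ⟨Or.symm, Or.symm⟩

theorem Adjacent.ne (h : Adjacent e x y) : x ≠ y := by
  rintro rfl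
  rcases h with h | h <;> omega

theorem adjacent_mul : Adjacent (e * π) x y ↔ Adjacent e (π x) (π y) := Iff.rfl

theorem orderSign_comm (h : x ≠ y) : orderSign e f x y = orderSign e f y x := by
  have h1 : (e x : ℕ) ≠ e y := by rwa [Ne, val_eq_iff]
  have h2 : (f x : ℕ) ≠ f y := by rwa [Ne, val_eq_iff]
  unfold orderSign
  simp only [Fin.lt_def]
  congr 1
  apply propext
  omega

theorem orderSign_eq_or : orderSign e f x y = 1 ∨ orderSign e f x y = -1 := by
  unfold orderSign
  split_ifs <;> simp

theorem orderSign_congr {e' f' : Perm (Fin n)} {x' y' : Fin n} (h1 : e x = e' x') (h2 : e y = e' y')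
    (h3 : f x = f' x') (h4 : f y = f' y') : orderSign e f x y = orderSign e' f' x' y' := by
  unfold orderSign
  rw [h1, h2, h3, h4]

theorem orderSign_swap_left (h : x ≠ y) :
    orderSign (e * swap x y) f x y = -orderSign e f x y := by
  have h1 : (e x : ℕ) ≠ e y := by rwa [Ne, val_eq_iff]
  unfold orderSign
  simp only [Perm.mul_apply, swap_apply_left, swap_apply_right, Fin.lt_def]
  split_ifs <;> first | rfl | omega

theorem orderSign_swap_right (h : x ≠ y) :
    orderSign e (f * swap x y) x y = -orderSign e f x y := by
  have h1 : (f x : ℕ) ≠ f y := by rwa [Ne, val_eq_iff]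
  unfold orderSign
  simp only [Perm.mul_apply, swap_apply_left, swap_apply_right, Fin.lt_def]
  split_ifs <;> first | rfl | omega

theorem mem_relDescents :
    x ∈ relDescents e f ↔ ∃ y, (e y : ℕ) = e x + 1 ∧ f y < f x := by
  simp [relDescents]

theorem relDes_mul_mul (e f g : Perm (Fin n)) : relDes (e * g) (f * g) = relDes e f := by
  apply Finset.card_bij (fun x _ => g x)
  · intro x hx
    obtain ⟨y, h⟩ := mem_relDescents.1 hx
    exact mem_relDescents.2 ⟨g y, h⟩
  · intro x _ y _ h
    exact g.injective h
  · intro x hx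
    obtain ⟨y, h⟩ := mem_relDescents.1 hx
    exact ⟨g⁻¹ x, mem_relDescents.2 ⟨g⁻¹ y, by simpa using h⟩, by simp⟩

/-- Only the relative labelling of positions and values matters, so an exchange of positions can be
traded for one in the word. -/
theorem relDes_mul_swap_left (e f : Perm (Fin n)) (a b : Fin n) :
    relDes (e * swap a b) f = relDes e (f * swap a b) := by
  conv_lhs => rw [show f = f * swap a b * swap a b by rw [mul_assoc, swap_mul_self, mul_one]]
  exact relDes_mul_mul _ _ _

theorem mem_descentSet {i : Fin n} :
    i ∈ descentSet π ↔ ∃ h : (i : ℕ) + 1 < n, π ⟨(i : ℕ) + 1, h⟩ < π i := by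
  simp [descentSet]

theorem des_conj (π e : Perm (Fin n)) : des (e * π * e⁻¹) = orderDes π e := by
  unfold des orderDes relDes
  apply Finset.card_bij (fun x _ => e⁻¹ x)
  · intro x hx
    obtain ⟨h, h'⟩ := mem_descentSet.1 hx
    exact mem_relDescents.2 ⟨e⁻¹ ⟨x + 1, h⟩, by simp, h'⟩
  · intro x _ y _ h
    exact e⁻¹.injective h
  · intro x hx
    obtain ⟨y, h, h'⟩ := mem_relDescents.1 hx
    have hy : (e x : ℕ) + 1 < n := h ▸ (e y).2
    have : (⟨(e x : ℕ) + 1, hy⟩ : Fin n) = e y := Fin.ext h.symm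
    exact ⟨e x, mem_descentSet.2 ⟨hy, by simpa [this] using h'⟩, by simp⟩

/-- Swapping two neighbouring values does not change any comparison but their own. -/
theorem mul_swap_lt_iff (hf : Adjacent f p q) (h1 : ¬(x = p ∧ y = q)) (h2 : ¬(x = q ∧ y = p)) :
    (f * swap p q) x < (f * swap p q) y ↔ f x < f y := by
  have hpq := hf.ne
  have hv : ∀ {u v : Fin n}, u ≠ v → (f u : ℕ) ≠ f v := fun h => by rwa [Ne, val_eq_iff]
  simp only [Perm.mul_apply, Fin.lt_def]
  by_cases hxp : x = p
  · subst hxp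
    by_cases hyx : y = x
    · subst hyx; simp
    have hyq : y ≠ q := fun h => h1 ⟨rfl, h⟩
    rw [swap_apply_left, swap_apply_of_ne_of_ne hyx hyq]
    have := hv hyx; have := hv hyq
    unfold Adjacent at hf
    omega
  by_cases hxq : x = q
  · subst hxq
    by_cases hyx : y = x
    · subst hyx; simp
    have hyp : y ≠ p := fun h => h2 ⟨rfl, h⟩
    rw [swap_apply_right, swap_apply_of_ne_of_ne hyp hyx]
    have := hv hyx; have := hv hyp
    unfold Adjacent at hf
    omega
  rw [swap_apply_of_ne_of_ne hxp hxq]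
  have := hv hxp; have := hv hxq
  unfold Adjacent at hf
  rw [swap_apply_def]
  split_ifs with h3 h4
  · subst h3; omega
  · subst h4; omega
  · rfl

/-- Exchanging neighbouring values affects only the comparison of `p` with `q`, which counts only if
they are also neighbouring positions. A non-descent (sign `1`) then becomes a descent, and
conversely. -/
theorem relDes_mul_swap_of_adjacent (hf : Adjacent f p q) :
    (relDes e (f * swap p q) : ℤ) =
      relDes e f + if Adjacent e p q then orderSign e f p q else 0 := by
  have hpq := hf.ne
  by_cases he : Adjacent e p q
  · rw [if_pos he]
    wlog h : (e q : ℕ) = e p + 1 generalizing p q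
    · have h' : (e p : ℕ) = e q + 1 := he.resolve_left h
      rw [swap_comm, orderSign_comm hpq]
      exact this hf.symm hpq.symm he.symm h'
    have key : ∀ x, x ≠ p → ((∃ y, (e y : ℕ) = e x + 1 ∧ (f * swap p q) y < (f * swap p q) x) ↔
        ∃ y, (e y : ℕ) = e x + 1 ∧ f y < f x) := by
      intro x hx
      refine exists_congr fun y => and_congr_right fun hy => mul_swap_lt_iff hf ?_ ?_
      · rintro ⟨rfl, rfl⟩; omega
      · rintro ⟨rfl, rfl⟩; exact hx rfl
    have hp : ∀ g : Perm (Fin n), (∃ y, (e y : ℕ) = e p + 1 ∧ g y < g p) ↔ g q < g p := by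
      intro g
      constructor
      · rintro ⟨y, hy, h'⟩
        rwa [(val_eq_iff e y q).1 (by omega)] at h'
      · exact fun h' => ⟨q, h, h'⟩
    have hne : (f p : ℕ) ≠ f q := by rwa [Ne, val_eq_iff]
    unfold relDes orderSign
    have hlt : e p < e q := by rw [Fin.lt_def]; omega
    simp only [hlt, true_iff]
    by_cases hfpq : f p < f q
    · have : relDescents e (f * swap p q) = insert p (relDescents e f) := by
        ext x
        simp only [mem_relDescents, Finset.mem_insert]
        by_cases hx : x = p
        · subst hx
          rw [hp]
          simpa using hfpq
        · rw [key x hx]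
          simp [hx]
      rw [this, Finset.card_insert_of_notMem, if_pos hfpq]
      · simp
      · simp only [mem_relDescents]
        rw [hp]
        exact hfpq.le.not_gt
    · have hqp : f q < f p := by rw [Fin.lt_def] at *; omega
      have : relDescents e f = insert p (relDescents e (f * swap p q)) := by
        ext x
        simp only [mem_relDescents, Finset.mem_insert]
        by_cases hx : x = p
        · subst hx
          rw [hp]
          simpa using hqp
        · rw [key x hx]
          simp [hx]
      rw [this, Finset.card_insert_of_notMem, if_neg hfpq]
      · simp
      · simp only [mem_relDescents]
        rw [hp]
        simpa using hqp.le
  · rw [if_neg he, add_zero]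
    unfold relDes
    congr 2
    ext x
    simp only [mem_relDescents]
    refine exists_congr fun y => and_congr_right fun hy => mul_swap_lt_iff hf ?_ ?_
    · rintro ⟨rfl, rfl⟩; exact he (Or.inr hy)
    · rintro ⟨rfl, rfl⟩; exact he (Or.inl hy)

/-- Three comparisons are affected: within the pair and with its outer neighbours. If the pair was
ascending, it gains one descent and the outer comparisons gain none. If it was descending, it loses
one and the outer ones gain at most two. -/
theorem relDes_mul_swap_le (he : Adjacent e a b) :
    relDes e (f * swap a b) ≤ relDes e f + 1 := by
  wlog h : (e b : ℕ) = e a + 1 generalizing a b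
  · rw [swap_comm]
    exact this he.symm (he.resolve_left h)
  have hab := he.ne
  have hne : (f a : ℕ) ≠ f b := by rwa [Ne, val_eq_iff]
  have ha : ∀ g : Perm (Fin n), (∃ y, (e y : ℕ) = e a + 1 ∧ g y < g a) ↔ g b < g a := by
    intro g
    constructor
    · rintro ⟨y, hy, h'⟩
      rwa [(val_eq_iff e y b).1 (by omega)] at h'
    · exact fun h' => ⟨b, h, h'⟩
  unfold relDes
  by_cases hf : f a < f b
  · rw [← Nat.succ_eq_add_one]
    refine (Finset.card_le_card ?_).trans (Finset.card_insert_le a _)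
    intro x hx
    simp only [mem_relDescents, Finset.mem_insert] at hx ⊢
    by_cases hxa : x = a
    · exact Or.inl hxa
    refine Or.inr ?_
    obtain ⟨y, hy, hlt⟩ := hx
    refine ⟨y, hy, ?_⟩
    have hyb : y ≠ b := by
      rintro rfl
      exact hxa ((val_eq_iff e x a).1 (by omega))
    by_cases hya : y = a
    · subst hya
      have hxb : x ≠ b := by rintro rfl; omega
      rw [Perm.mul_apply, swap_apply_left, Perm.mul_apply, swap_apply_of_ne_of_ne hxa hxb] at hlt
      exact hf.trans hlt
    · rw [Perm.mul_apply, swap_apply_of_ne_of_ne hya hyb] at hlt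
      by_cases hxb : x = b
      · subst hxb
        rw [Perm.mul_apply, swap_apply_right] at hlt
        exact hlt.trans hf
      · rwa [Perm.mul_apply, swap_apply_of_ne_of_ne hxa hxb] at hlt
  · have hba : f b < f a := by rw [Fin.lt_def] at *; omega
    set S := relDescents e f with hS
    have haS : a ∈ S := by
      simp only [hS, mem_relDescents]
      exact (ha f).2 hba
    have hcard := Finset.card_erase_add_one haS
    by_cases hx0 : ∃ x0, (e a : ℕ) = e x0 + 1
    · obtain ⟨x0, hx0⟩ := hx0
      have : relDescents e (f * swap a b) ⊆ insert x0 (insert b (S.erase a)) := by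
        intro x hx
        simp only [mem_relDescents, Finset.mem_insert,
          Finset.mem_erase] at hx ⊢
        by_cases hxx : x = x0
        · exact Or.inl hxx
        by_cases hxb : x = b
        · exact Or.inr (Or.inl hxb)
        have hxa : x ≠ a := by
          rintro rfl
          rw [ha] at hx
          simp at hx
          exact hx.not_gt hba
        refine Or.inr (Or.inr ⟨hxa, ?_⟩)
        obtain ⟨y, hy, hlt⟩ := hx
        have hya : y ≠ a := by
          rintro rfl
          exact hxx ((val_eq_iff e x x0).1 (by omega))
        have hyb : y ≠ b := by
          rintro rfl
          exact hxa ((val_eq_iff e x a).1 (by omega))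
        simp only [hS, mem_relDescents]
        refine ⟨y, hy, ?_⟩
        rwa [Perm.mul_apply, Perm.mul_apply, swap_apply_of_ne_of_ne hya hyb,
          swap_apply_of_ne_of_ne hxa hxb] at hlt
      have h1 := Finset.card_le_card this
      have h2 := Finset.card_insert_le x0 (insert b (S.erase a))
      have h3 := Finset.card_insert_le b (S.erase a)
      omega
    · have : relDescents e (f * swap a b) ⊆ insert b (S.erase a) := by
        intro x hx
        simp only [mem_relDescents, Finset.mem_insert,
          Finset.mem_erase] at hx ⊢
        by_cases hxb : x = b
        · exact Or.inl hxb
        have hxa : x ≠ a := by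
          rintro rfl
          rw [ha] at hx
          simp at hx
          exact hx.not_gt hba
        refine Or.inr ⟨hxa, ?_⟩
        obtain ⟨y, hy, hlt⟩ := hx
        have hya : y ≠ a := by
          rintro rfl
          exact hx0 ⟨x, hy⟩
        have hyb : y ≠ b := by
          rintro rfl
          exact hxa ((val_eq_iff e x a).1 (by omega))
        simp only [hS, mem_relDescents]
        refine ⟨y, hy, ?_⟩
        rwa [Perm.mul_apply, Perm.mul_apply, swap_apply_of_ne_of_ne hya hyb,
          swap_apply_of_ne_of_ne hxa hxb] at hlt
      have h1 := Finset.card_le_card this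
      have h3 := Finset.card_insert_le b (S.erase a)
      omega

theorem abs_relDes_swap_mul_sub_le (he : Adjacent e a b) :
    |(relDes (e * swap a b) f : ℤ) - relDes e f| ≤ 1 := by
  rw [relDes_mul_swap_left]
  have h1 := relDes_mul_swap_le (f := f) he
  have h2 := relDes_mul_swap_le (f := f * swap a b) he
  rw [mul_assoc, swap_mul_self, mul_one] at h2
  rw [abs_le]
  omega

end Basic

/-! ### Jumps over a value and the backward orbit of a pair -/

/-- The pairs `{x, y}` and `{a, b}` have no element in common. -/
def PairDisjoint {n : ℕ} (x y a b : Fin n) : Prop := x ≠ a ∧ x ≠ b ∧ y ≠ a ∧ y ≠ b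

/-- The pairs `{x, y}` and `{a, b}` are equal. -/
def PairEq {n : ℕ} (x y a b : Fin n) : Prop := (x = a ∧ y = b) ∨ (x = b ∧ y = a)

section Flip

variable {n : ℕ} {e π : Perm (Fin n)} {x y a b : Fin n}

theorem PairDisjoint.symm (h : PairDisjoint x y a b) : PairDisjoint a b x y :=
  ⟨h.1.symm, h.2.2.1.symm, h.2.1.symm, h.2.2.2.symm⟩

theorem PairDisjoint.map (h : PairDisjoint x y a b) (g : Perm (Fin n)) :
    PairDisjoint (g x) (g y) (g a) (g b) :=
  ⟨g.injective.ne h.1, g.injective.ne h.2.1, g.injective.ne h.2.2.1, g.injective.ne h.2.2.2⟩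

theorem PairEq.map (h : PairEq x y a b) (g : Perm (Fin n)) : PairEq (g x) (g y) (g a) (g b) := by
  rcases h with ⟨rfl, rfl⟩ | ⟨rfl, rfl⟩
  · exact Or.inl ⟨rfl, rfl⟩
  · exact Or.inr ⟨rfl, rfl⟩

theorem PairEq.adjacent_iff (h : PairEq x y a b) : Adjacent e x y ↔ Adjacent e a b := by
  rcases h with ⟨rfl, rfl⟩ | ⟨rfl, rfl⟩
  · rfl
  · exact adjacent_comm

theorem PairDisjoint.swap_left (h : PairDisjoint x y a b) : (e * swap a b) x = e x := by
  rw [Perm.mul_apply, swap_apply_of_ne_of_ne h.1 h.2.1]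

theorem PairDisjoint.swap_right (h : PairDisjoint x y a b) : (e * swap a b) y = e y := by
  rw [Perm.mul_apply, swap_apply_of_ne_of_ne h.2.2.1 h.2.2.2]

theorem PairDisjoint.adjacent_mul_swap (h : PairDisjoint x y a b) :
    Adjacent (e * swap a b) x y ↔ Adjacent e x y := by
  unfold Adjacent
  rw [h.swap_left, h.swap_right]

theorem Adjacent.mul_swap (h : Adjacent e a b) : Adjacent (e * swap a b) a b := by
  unfold Adjacent
  rw [Perm.mul_apply, Perm.mul_apply, swap_apply_left, swap_apply_right]
  exact Or.symm h

/-- A pair that is adjacent before and after exchanging the neighbours `a` and `b` equals `{a, b}`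
or is disjoint from it. -/
theorem pairEq_or_pairDisjoint (h : Adjacent e a b) (h1 : Adjacent e x y)
    (h2 : Adjacent (e * swap a b) x y) : PairEq x y a b ∨ PairDisjoint x y a b := by
  have hv : ∀ {u v : Fin n}, u ≠ v → (e u : ℕ) ≠ e v := fun h => by rwa [Ne, val_eq_iff]
  have hab := hv h.ne
  have hxy := hv h1.ne
  have hne := h1.ne
  unfold PairEq PairDisjoint
  by_cases hxa : x = a
  · subst hxa
    by_cases hyb : y = b
    · exact Or.inl (Or.inl ⟨rfl, hyb⟩)
    have := hv hyb
    unfold Adjacent at *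
    rw [Perm.mul_apply, Perm.mul_apply, swap_apply_left, swap_apply_of_ne_of_ne hne.symm hyb] at h2
    omega
  by_cases hxb : x = b
  · subst hxb
    by_cases hya : y = a
    · exact Or.inl (Or.inr ⟨rfl, hya⟩)
    have := hv hya
    unfold Adjacent at *
    rw [Perm.mul_apply, Perm.mul_apply, swap_apply_right, swap_apply_of_ne_of_ne hya hne.symm] at h2
    omega
  have hx1 := hv hxa
  have hx2 := hv hxb
  unfold Adjacent at *
  rw [Perm.mul_apply, Perm.mul_apply, swap_apply_of_ne_of_ne hxa hxb] at h2
  by_cases hya : y = a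
  · subst hya
    rw [swap_apply_left] at h2
    omega
  by_cases hyb : y = b
  · subst hyb
    rw [swap_apply_right] at h2
    omega
  exact Or.inr ⟨hxa, hxb, hya, hyb⟩

/-- `1` if `π` preserves the `e`-order of `x` and `y`, and `-1` if it reverses it. -/
def linkSign (π e : Perm (Fin n)) (x y : Fin n) : ℤ := orderSign e (e * π) x y

theorem linkSign_eq_or : linkSign π e x y = 1 ∨ linkSign π e x y = -1 := orderSign_eq_or

theorem mul_swap_mul (e π : Perm (Fin n)) (a b : Fin n) :
    e * swap a b * π = e * π * swap (π⁻¹ a) (π⁻¹ b) := by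
  rw [mul_assoc, mul_assoc, swap_mul_eq_mul_swap]

theorem adjacent_mul_inv (h : Adjacent e a b) : Adjacent (e * π) (π⁻¹ a) (π⁻¹ b) := by
  rw [adjacent_mul]
  simpa using h

/-- The exchange acts on the positions `a`, `b` and on the values carried by their preimages. As the
two pairs are disjoint, the effects add up. -/
theorem orderDes_mul_swap (h : Adjacent e a b) (hπ : Adjacent e (π a) (π b))
    (hd : PairDisjoint (π⁻¹ a) (π⁻¹ b) a b) :
    (orderDes π (e * swap a b) : ℤ) = orderDes π e + linkSign π e a b +
      if Adjacent e (π⁻¹ a) (π⁻¹ b) then linkSign π e (π⁻¹ a) (π⁻¹ b) else 0 := by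
  unfold orderDes linkSign
  rw [mul_swap_mul, relDes_mul_swap_left]
  rw [relDes_mul_swap_of_adjacent (hd.symm.adjacent_mul_swap.2 (adjacent_mul.2 hπ)), if_pos h,
    relDes_mul_swap_of_adjacent (adjacent_mul_inv h)]
  have : orderSign e (e * π * swap (π⁻¹ a) (π⁻¹ b)) a b = orderSign e (e * π) a b :=
    orderSign_congr rfl rfl hd.symm.swap_left hd.symm.swap_right
  rw [this]
  ring

theorem linkSign_mul_swap_inv (h : a ≠ b) (hd : PairDisjoint (π⁻¹ a) (π⁻¹ b) a b) :
    linkSign π (e * swap a b) (π⁻¹ a) (π⁻¹ b) = -linkSign π e (π⁻¹ a) (π⁻¹ b) := by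
  unfold linkSign
  rw [mul_swap_mul, orderSign_swap_right (π⁻¹.injective.ne h)]
  exact congrArg _ (orderSign_congr hd.swap_left hd.swap_right rfl rfl)

theorem linkSign_mul_swap_of_disjoint (h : PairDisjoint x y a b)
    (hd : PairDisjoint (π x) (π y) a b) :
    linkSign π (e * swap a b) x y = linkSign π e x y := by
  unfold linkSign
  refine orderSign_congr h.swap_left h.swap_right ?_ ?_
  · exact hd.swap_left
  · exact hd.swap_right

/-- If the backward chain of adjacent pairs starting at `{a, b}` breaks after `h` steps and its
members are disjoint, the number of descents can be changed by exactly the sign of the first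
link. -/
theorem exists_orderDes_of_chain (h : ℕ) : ∀ (e : Perm (Fin n)) (a b : Fin n),
    Adjacent e (π a) (π b) →
    (∀ j ≤ h, Adjacent e ((π⁻¹ ^ j) a) ((π⁻¹ ^ j) b)) →
    ¬ Adjacent e ((π⁻¹ ^ (h + 1)) a) ((π⁻¹ ^ (h + 1)) b) →
    (∀ j, 1 ≤ j → j ≤ h + 1 → PairDisjoint ((π⁻¹ ^ j) a) ((π⁻¹ ^ j) b) a b) →
    ∃ e', (orderDes π e' : ℤ) = orderDes π e + linkSign π e a b := by
  induction h with
  | zero =>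
    intro e a b hπ h0 h1 hd
    refine ⟨e * swap a b, ?_⟩
    have h0 := h0 0 le_rfl
    have hd := hd 1 le_rfl le_rfl
    simp only [zero_add, pow_one, pow_zero, Perm.one_apply] at h0 h1 hd
    rw [orderDes_mul_swap h0 hπ hd, if_neg h1, add_zero]
  | succ h ih =>
    intro e a b hπ h0 h1 hd
    have hab : Adjacent e a b := by simpa using h0 0 (Nat.zero_le _)
    have hpre : Adjacent e (π⁻¹ a) (π⁻¹ b) := by simpa using h0 1 (by omega)
    have hd1 : PairDisjoint (π⁻¹ a) (π⁻¹ b) a b := by simpa using hd 1 le_rfl (by omega)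
    have hs : ∀ j : ℕ, ∀ x, (π⁻¹ ^ j) (π⁻¹ x) = (π⁻¹ ^ (j + 1)) x := by
      intro j x; rw [pow_succ, Perm.mul_apply]
    have hdis : ∀ j, 1 ≤ j → j ≤ h + 1 → PairDisjoint ((π⁻¹ ^ j) (π⁻¹ a)) ((π⁻¹ ^ j) (π⁻¹ b))
        (π⁻¹ a) (π⁻¹ b) := by
      intro j hj1 hj2
      have := (hd j hj1 (by omega)).map π⁻¹
      simpa only [← Perm.mul_apply, ← pow_succ, ← pow_succ'] using this
    -- If the next link has the same sign, start from it instead. Otherwise exchange `a` and `b`: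
    -- the two effects cancel, and the next link changes its sign to the desired one.
    by_cases hsg : linkSign π e (π⁻¹ a) (π⁻¹ b) = linkSign π e a b
    · rw [← hsg]
      refine ih e _ _ (by simpa using hab) ?_ ?_ hdis
      · intro j hj
        rw [hs, hs]
        exact h0 _ (by omega)
      · rwa [hs, hs]
    · have hopp : linkSign π e (π⁻¹ a) (π⁻¹ b) = -linkSign π e a b := by
        rcases linkSign_eq_or (π := π) (e := e) (x := π⁻¹ a) (y := π⁻¹ b) with h2 | h2 <;>
        rcases linkSign_eq_or (π := π) (e := e) (x := a) (y := b) with h3 | h3 <;> omega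
      have hflip := orderDes_mul_swap hab hπ hd1
      rw [if_pos hpre, hopp] at hflip
      have := ih (e * swap a b) (π⁻¹ a) (π⁻¹ b) (by simpa using hab.mul_swap) ?_ ?_ hdis
      · obtain ⟨e', he'⟩ := this
        refine ⟨e', ?_⟩
        rw [he', linkSign_mul_swap_inv hab.ne hd1, hopp, hflip]
        ring
      · intro j hj
        rw [hs, hs, (hd (j + 1) (by omega) (by omega)).adjacent_mul_swap]
        exact h0 _ (by omega)
      · rwa [hs, hs, (hd (h + 1 + 1) (by omega) le_rfl).adjacent_mul_swap]

/-- Exchanging the `e`-neighbours `a` and `b` makes the number of descents jump over `k`, from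
`k - ε` to `k + ε`. -/
structure IsJump (π : Perm (Fin n)) (k ε : ℤ) (e : Perm (Fin n)) (a b : Fin n) : Prop where
  sign : ε = 1 ∨ ε = -1
  adjacent : Adjacent e a b
  source : (orderDes π e : ℤ) = k - ε
  target : (orderDes π (e * swap a b) : ℤ) = k + ε

variable {k ε : ℤ}

theorem IsJump.reverse (h : IsJump π k ε e a b) : IsJump π k (-ε) (e * swap a b) a b where
  sign := by rcases h.sign with h | h <;> simp [h]
  adjacent := h.adjacent.mul_swap
  source := by rw [h.target]; ring
  target := by rw [mul_assoc, swap_mul_self, mul_one, h.source]; ring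

/-- Exchanging positions contributes at most 1 in absolute value, so the exchange of values must
contribute exactly `ε`. -/
theorem IsJump.preimage (h : IsJump π k ε e a b) :
    Adjacent e (π⁻¹ a) (π⁻¹ b) ∧ linkSign π e (π⁻¹ a) (π⁻¹ b) = ε := by
  have h1 := h.source
  have h2 := h.target
  unfold orderDes at h1 h2
  rw [mul_swap_mul] at h2
  have h3 := relDes_mul_swap_of_adjacent (e := e) (adjacent_mul_inv (π := π) h.adjacent)
  have h4 := abs_relDes_swap_mul_sub_le (f := e * π * swap (π⁻¹ a) (π⁻¹ b)) h.adjacent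
  rw [abs_le] at h4
  unfold linkSign
  by_cases hc : Adjacent e (π⁻¹ a) (π⁻¹ b)
  · rw [if_pos hc] at h3
    refine ⟨hc, ?_⟩
    rcases h.sign with hε | hε <;>
    rcases orderSign_eq_or (e := e) (f := e * π) (x := π⁻¹ a) (y := π⁻¹ b) with h5 | h5 <;> omega
  · rw [if_neg hc] at h3
    rcases h.sign with hε | hε <;> omega

/-- If the preimage pair were `{a, b}` itself, the exchange would reverse it in both orders and keep
its link sign, whereas the reversed jump requires the opposite sign. -/
theorem IsJump.preimage_disjoint (h : IsJump π k ε e a b) :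
    PairDisjoint (π⁻¹ a) (π⁻¹ b) a b := by
  have h1 := h.preimage
  have h2 := h.reverse.preimage
  rcases pairEq_or_pairDisjoint h.adjacent h1.1 h2.1 with h3 | h3
  · exfalso
    have hsame : linkSign π (e * swap a b) (π⁻¹ a) (π⁻¹ b) = linkSign π e (π⁻¹ a) (π⁻¹ b) := by
      unfold linkSign
      rw [mul_swap_mul]
      have hsw : swap a b = swap (π⁻¹ a) (π⁻¹ b) := by
        rcases h3 with ⟨h3, h4⟩ | ⟨h3, h4⟩
        · rw [h3, h4]
        · rw [h3, h4, swap_comm]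
      have hne := π⁻¹.injective.ne h.adjacent.ne
      rw [hsw, orderSign_swap_left hne, orderSign_swap_right hne, neg_neg]
    rw [h1.2, h2.2] at hsame
    rcases h.sign with hε | hε <;> omega
  · exact h3

/-- Exchanging the preimages instead of `a`, `b` makes up for the `ε` missing from `k`, so only the
link of the second preimages can keep the count away from `k`. -/
theorem IsJump.orderDes_swap_preimage (h : IsJump π k ε e a b) :
    (orderDes π (e * swap (π⁻¹ a) (π⁻¹ b)) : ℤ) = k +
      if Adjacent e (π⁻¹ (π⁻¹ a)) (π⁻¹ (π⁻¹ b)) then linkSign π e (π⁻¹ (π⁻¹ a)) (π⁻¹ (π⁻¹ b))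
      else 0 := by
  rw [orderDes_mul_swap h.preimage.1 (by simpa using h.adjacent) (h.preimage_disjoint.map π⁻¹),
    h.preimage.2, h.source]
  ring

/-- A jump at `{a, b}` over an unattained value propagates to the preimage of `{a, b}`. -/
theorem IsJump.step (hk : ∀ e, (orderDes π e : ℤ) ≠ k) (h : IsJump π k ε e a b) :
    (∃ δ, IsJump π k δ e (π⁻¹ a) (π⁻¹ b)) ∨ (∃ δ, IsJump π k δ (e * swap a b) (π⁻¹ a) (π⁻¹ b)) ∨
      PairEq (π⁻¹ (π⁻¹ a)) (π⁻¹ (π⁻¹ b)) a b := by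
  have key : ∀ {e ε}, IsJump π k ε e a b → Adjacent e (π⁻¹ (π⁻¹ a)) (π⁻¹ (π⁻¹ b)) := by
    intro e ε h
    by_contra hc
    apply hk (e * swap (π⁻¹ a) (π⁻¹ b))
    rw [h.orderDes_swap_preimage, if_neg hc, add_zero]
  have make : ∀ {e ε}, IsJump π k ε e a b → linkSign π e (π⁻¹ (π⁻¹ a)) (π⁻¹ (π⁻¹ b)) = ε →
      IsJump π k ε e (π⁻¹ a) (π⁻¹ b) := by
    intro e ε h hs
    refine ⟨h.sign, h.preimage.1, h.source, ?_⟩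
    rw [h.orderDes_swap_preimage, if_pos (key h), hs]
  by_cases hs : linkSign π e (π⁻¹ (π⁻¹ a)) (π⁻¹ (π⁻¹ b)) = ε
  · exact Or.inl ⟨ε, make h hs⟩
  · rcases pairEq_or_pairDisjoint h.adjacent (key h) (key h.reverse) with h3 | h3
    · exact Or.inr (Or.inr h3)
    -- The link sign is the same in both orders, while the reversed jump has sign `-ε`; so it
    -- matches one of the two jumps.
    · refine Or.inr (Or.inl ⟨-ε, make h.reverse ?_⟩)
      rw [linkSign_mul_swap_of_disjoint h3 (by simpa using h.preimage_disjoint)]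
      rcases h.sign with hε | hε <;>
      rcases linkSign_eq_or (π := π) (e := e) (x := π⁻¹ (π⁻¹ a)) (y := π⁻¹ (π⁻¹ b)) with h5 | h5 <;>
      omega

/-- All the preimages of a jump over an unattained value are adjacent pairs. -/
theorem IsJump.adjacent_iterate (hk : ∀ e, (orderDes π e : ℤ) ≠ k) (m : ℕ) :
    ∀ {ε : ℤ} {e : Perm (Fin n)} {a b : Fin n}, IsJump π k ε e a b →
      Adjacent e ((π⁻¹ ^ m) a) ((π⁻¹ ^ m) b) := by
  induction m using Nat.strong_induction_on with
  | _ m ih =>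
    intro ε e a b h
    by_contra hm
    have hs : ∀ j : ℕ, ∀ x, (π⁻¹ ^ j) (π⁻¹ x) = (π⁻¹ ^ (j + 1)) x := by
      intro j x; rw [pow_succ, Perm.mul_apply]
    have hm2 : 2 ≤ m := by
      by_contra hlt
      have : m = 0 ∨ m = 1 := by omega
      rcases this with rfl | rfl
      · exact hm (by simpa using h.adjacent)
      · exact hm (by simpa using h.preimage.1)
    obtain ⟨l, rfl⟩ : ∃ l, m = l + 2 := ⟨m - 2, by omega⟩
    -- Had the orbit returned to `{a, b}` at step `j`, the pair at step `m` would be the one at step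
    -- `m - j`, adjacent by induction.
    have hper : ∀ j, 1 ≤ j → j ≤ l + 1 → ¬ PairEq ((π⁻¹ ^ j) a) ((π⁻¹ ^ j) b) a b := by
      intro j hj1 hj2 heq
      have h1 := heq.map (π⁻¹ ^ (l + 2 - j))
      rw [← Perm.mul_apply, ← Perm.mul_apply, ← pow_add, Nat.sub_add_cancel (by omega)] at h1
      exact hm (h1.adjacent_iff.2 (ih _ (by omega) h))
    rcases h.step hk with ⟨δ, h1⟩ | ⟨δ, h1⟩ | h1
    · have := ih (l + 1) (by omega) h1
      rw [hs, hs] at this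
      exact hm this
    -- By induction for both jumps, these pairs are adjacent before and after the exchange of `a`
    -- and `b`.
    · have hdis : ∀ j, 1 ≤ j → j ≤ l + 1 → PairDisjoint ((π⁻¹ ^ j) a) ((π⁻¹ ^ j) b) a b := by
        intro j hj1 hj2
        refine (pairEq_or_pairDisjoint h.adjacent (ih j (by omega) h) ?_).resolve_left
          (hper j hj1 hj2)
        obtain ⟨i, rfl⟩ : ∃ i, j = i + 1 := ⟨j - 1, by omega⟩
        rw [← hs, ← hs]
        exact ih i (by omega) h1
      -- The first link of this chain has sign `ε`, so the count moves from `k - ε` to exactly `k`.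
      obtain ⟨e', he'⟩ := exists_orderDes_of_chain (π := π) l e (π⁻¹ a) (π⁻¹ b)
        (by simpa using h.adjacent)
        (fun j hj => by rw [hs, hs]; exact ih _ (by omega) h) (by rwa [hs, hs])
        (fun j hj1 hj2 => by
          have := (hdis j hj1 hj2).map π⁻¹
          simpa only [← Perm.mul_apply, ← pow_succ, ← pow_succ'] using this)
      apply hk e'
      rw [he', h.source, h.preimage.2]
      ring
    · by_cases hl : l = 0
      · subst hl
        refine hm ?_
        have : Adjacent e (π⁻¹ (π⁻¹ a)) (π⁻¹ (π⁻¹ b)) := h1.adjacent_iff.2 h.adjacent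
        simpa [pow_succ] using this
      · exact hper 2 (by omega) (by omega) (by simpa [pow_succ] using h1)

theorem IsJump.pairEq_or_pairDisjoint_iterate (hk : ∀ e, (orderDes π e : ℤ) ≠ k)
    (h : IsJump π k ε e a b) (m : ℕ) :
    PairEq ((π⁻¹ ^ m) a) ((π⁻¹ ^ m) b) a b ∨ PairDisjoint ((π⁻¹ ^ m) a) ((π⁻¹ ^ m) b) a b :=
  pairEq_or_pairDisjoint h.adjacent (h.adjacent_iterate hk m) (h.reverse.adjacent_iterate hk m)

end Flip

/-! ### Building orders and finding descents in them -/

section Orders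

variable {n : ℕ} {e f π : Perm (Fin n)} {x y z : Fin n}

theorem exists_order_of_key {α : Type*} [LinearOrder α] (key : Fin n → α) :
    ∃ e : Perm (Fin n), ∀ x y, key x < key y → e x < e y := by
  refine ⟨(Tuple.sort key)⁻¹, fun x y hxy => ?_⟩
  by_contra h
  have := Tuple.monotone_sort key (not_lt.1 h)
  have hs : ∀ z, (Tuple.sort key) ((Tuple.sort key)⁻¹ z) = z := fun z => by simp
  rw [Function.comp_apply, Function.comp_apply, hs, hs] at this
  exact this.not_gt hxy

theorem exists_succ_of_lt (h : e x < e y) : ∃ z, (e z : ℕ) = e x + 1 := by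
  refine ⟨e⁻¹ ⟨e x + 1, ?_⟩, by simp⟩
  have := (e y).2
  rw [Fin.lt_def] at h
  omega

/-- An inversion of `f` along `e` spans a descent. -/
theorem exists_descent_between (d : ℕ) : ∀ {x : Fin n}, (e y : ℕ) ≤ e x + d → e x < e y →
    f y < f x → ∃ z ∈ relDescents e f, e x ≤ e z ∧ e z < e y := by
  induction d with
  | zero =>
    intro x h1 h2
    rw [Fin.lt_def] at h2
    omega
  | succ d ih =>
    intro x h1 h2 h3
    obtain ⟨w, hw⟩ := exists_succ_of_lt h2
    by_cases hf : f w < f x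
    · exact ⟨x, mem_relDescents.2 ⟨w, hw, hf⟩, le_rfl, h2⟩
    · have hwy : w ≠ y := by rintro rfl; exact hf h3
      have hwy' : (e w : ℕ) ≠ e y := by rwa [Ne, val_eq_iff]
      have hlt : e w < e y := by rw [Fin.lt_def] at *; omega
      obtain ⟨z, hz, h4, h5⟩ := ih (by omega) hlt (h3.trans_le (not_lt.1 hf))
      refine ⟨z, hz, ?_, h5⟩
      rw [Fin.le_def] at *
      omega

theorem exists_mem_relDescents (h1 : e x < e y) (h2 : f y < f x) :
    ∃ z ∈ relDescents e f, e x ≤ e z ∧ e z < e y :=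
  exists_descent_between (e y) (by omega) h1 h2

theorem two_le_relDes (h1 : e x < e y) (h2 : e y < e z) (h3 : f y < f x) (h4 : f z < f y) :
    2 ≤ relDes e f := by
  obtain ⟨u, hu, _, hu2⟩ := exists_mem_relDescents h1 h3
  obtain ⟨v, hv, hv1, _⟩ := exists_mem_relDescents h2 h4
  have hne : u ≠ v := by rintro rfl; exact hu2.not_ge hv1
  unfold relDes
  rw [← Finset.card_pair hne]
  exact Finset.card_le_card (by simp [Finset.insert_subset_iff, hu, hv])

theorem eq_of_lt_imp_lt (h : ∀ x y, e x < e y → f x < f y) : f = e := by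
  have hmono : StrictMono (f * e⁻¹) := by
    intro i j hij
    have := h (e⁻¹ i) (e⁻¹ j) (by simpa using hij)
    simpa using this
  have := (Equiv.Perm.monotone_iff (f * e⁻¹)).1 hmono.monotone
  rw [← mul_inv_eq_one]
  exact this

theorem orderDes_pos (hπ : π ≠ 1) (e : Perm (Fin n)) : 0 < orderDes π e := by
  rw [Nat.pos_iff_ne_zero]
  intro h0
  apply hπ
  have : e * π = e := by
    apply eq_of_lt_imp_lt
    intro x y hxy
    by_contra hlt
    have hne : (e * π) y ≠ (e * π) x := fun h => by
      rw [(e * π).injective h] at hxy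
      exact lt_irrefl _ hxy
    obtain ⟨z, hz, -⟩ := exists_mem_relDescents hxy (lt_of_le_of_ne (not_lt.1 hlt) hne)
    unfold orderDes relDes at h0
    rw [Finset.card_eq_zero] at h0
    rw [h0] at hz
    exact Finset.notMem_empty _ hz
  simpa using this

theorem orderDes_one (e : Perm (Fin n)) : orderDes 1 e = 0 := by
  unfold orderDes relDes
  rw [Finset.card_eq_zero, Finset.eq_empty_iff_forall_notMem]
  intro x hx
  obtain ⟨y, h1, h2⟩ := mem_relDescents.1 hx
  rw [mul_one, Fin.lt_def] at h2
  omega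

theorem relDes_lt (hn : 0 < n) : relDes e f < n := by
  have hsub : relDescents e f ⊆ Finset.univ.erase (e⁻¹ ⟨n - 1, by omega⟩) := by
    intro x hx
    obtain ⟨y, h1, -⟩ := mem_relDescents.1 hx
    refine Finset.mem_erase.2 ⟨?_, Finset.mem_univ _⟩
    rintro rfl
    have := (e y).2
    simp at h1
    omega
  have := Finset.card_le_card hsub
  rw [Finset.card_erase_of_mem (Finset.mem_univ _), Finset.card_univ, Fintype.card_fin] at this
  unfold relDes
  omega

/-- A permutation with a moved point `x` and a point outside `{x, π x, π⁻¹ x}` has two descents in a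
suitable order. -/
theorem exists_two_le_orderDes {u : Fin n} (hx : π x ≠ x) (h1 : u ≠ x) (h2 : u ≠ π x)
    (h3 : u ≠ π⁻¹ x) : ∃ e, 2 ≤ orderDes π e := by
  -- The order begins with `x`, then `u`, and ends with `π x`. Thus `x`, `u`, `π⁻¹ x` increase while
  -- their images `π x`, `π u`, `x` decrease.
  obtain ⟨e, he⟩ := exists_order_of_key
    (fun z => if z = x then 0 else if z = π x then 3 else if z = u then 1 else 2 : Fin n → ℕ)
  have hp : π⁻¹ x ≠ x := fun h => hx (by rw [Perm.inv_eq_iff_eq] at h; exact h.symm)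
  have hu1 : π u ≠ π x := π.injective.ne h1
  have hu2 : π u ≠ x := fun h => h3 (by rw [Perm.eq_inv_iff_eq]; exact h)
  refine ⟨e, two_le_relDes (x := x) (y := u) (z := π⁻¹ x) (he _ _ ?_) (he _ _ ?_) (he _ _ ?_)
    (he _ _ ?_)⟩
  · simp [h1, h2]
  · simp only [h1, h2, hp, if_false, if_true, h3.symm]
    split_ifs <;> omega
  · simp only [hu1, hu2, hx, if_false, if_true]
    split_ifs <;> omega
  · simp only [show π (π⁻¹ x) = x by simp, hu1, hu2, if_false, if_true]
    split_ifs <;> omega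

end Orders

/-! ### Collapsing blocks of at most two points -/

section Contraction

variable {n n' : ℕ} {π e : Perm (Fin n)} {π' e' : Perm (Fin n')} {c : Fin n → Fin n'}

/-- The order `e` lists the fibres of `c` one after the other, in the order `e'`. -/
def Compatible (c : Fin n → Fin n') (e : Perm (Fin n)) (e' : Perm (Fin n')) : Prop :=
  ∀ x y, e' (c x) < e' (c y) → e x < e y

/-- The number of descents inside the fibres of `c`. -/
def fiberDes (c : Fin n → Fin n') (π e : Perm (Fin n)) : ℕ :=
  Finset.card {x : Fin n | ∃ y, c x = c y ∧ e x < e y ∧ e (π y) < e (π x)}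

theorem Compatible.le (h : Compatible c e e') {x y : Fin n} (hxy : e x ≤ e y) :
    e' (c x) ≤ e' (c y) := by
  by_contra hlt
  exact (h _ _ (not_le.1 hlt)).not_ge hxy

theorem Compatible.fiber_convex (h : Compatible c e e') {x y z : Fin n} (hxy : e x ≤ e y)
    (hyz : e y ≤ e z) (hc : c x = c z) : c y = c x := by
  have h1 := h.le hxy
  have h2 := h.le hyz
  rw [← hc] at h2
  exact e'.injective (le_antisymm h2 h1)

theorem Compatible.succ_of_fiber (h : Compatible c e e')
    (hfib : ∀ x y z, c x = c y → c x = c z → x = y ∨ x = z ∨ y = z) {x y : Fin n}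
    (hc : c x = c y) (hxy : e x < e y) : (e y : ℕ) = e x + 1 := by
  obtain ⟨z, hz⟩ := exists_succ_of_lt hxy
  have h1 : e x ≤ e z := by rw [Fin.le_def]; omega
  have h2 : e z ≤ e y := by rw [Fin.le_def]; rw [Fin.lt_def] at hxy; omega
  have hcz := h.fiber_convex h1 h2 hc
  rcases hfib x y z hc hcz.symm with rfl | rfl | rfl
  · exact absurd hxy (lt_irrefl _)
  · omega
  · exact hz

/-- Blocks are intervals of `e` with at most two points. Neighbours in one block give the fibre
descents; neighbours in different blocks compare as their blocks do, and each pair of consecutive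
blocks meets exactly once. -/
theorem orderDes_eq_add_fiberDes (h : Compatible c e e') (hsurj : Function.Surjective c)
    (hfib : ∀ x y z, c x = c y → c x = c z → x = y ∨ x = z ∨ y = z)
    (hπ : ∀ x, c (π x) = π' (c x)) : orderDes π e = orderDes π' e' + fiberDes c π e := by
  classical
  have hlt : ∀ {x y}, c x ≠ c y → e x < e y → e' (c x) < e' (c y) := fun hne hxy =>
    lt_of_le_of_ne (h.le hxy.le) (e'.injective.ne hne)
  set S1 : Finset (Fin n) :=
    {x : Fin n | ∃ y, c x = c y ∧ e x < e y ∧ e (π y) < e (π x)} with hS1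
  set S2 : Finset (Fin n) :=
    {x : Fin n | ∃ y, c x ≠ c y ∧ (e y : ℕ) = e x + 1 ∧ e (π y) < e (π x)} with hS2
  have hunion : relDescents e (e * π) = S2 ∪ S1 := by
    ext x
    rw [mem_relDescents, Finset.mem_union, hS1, hS2]
    simp only [Finset.mem_filter_univ]
    constructor
    · rintro ⟨y, h1, h2⟩
      by_cases hc : c x = c y
      · exact Or.inr ⟨y, hc, by rw [Fin.lt_def]; omega, h2⟩
      · exact Or.inl ⟨y, hc, h1, h2⟩
    · rintro (⟨y, -, h1, h2⟩ | ⟨y, hc, h1, h2⟩)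
      · exact ⟨y, h1, h2⟩
      · exact ⟨y, h.succ_of_fiber hfib hc h1, h2⟩
  have hdisj : Disjoint S2 S1 := by
    rw [Finset.disjoint_left]
    intro x hx2 hx1
    rw [hS1, Finset.mem_filter_univ] at hx1
    rw [hS2, Finset.mem_filter_univ] at hx2
    obtain ⟨y, hc, h1, -⟩ := hx1
    obtain ⟨z, hcz, h2, -⟩ := hx2
    have := h.succ_of_fiber hfib hc h1
    exact hcz (by rwa [← (val_eq_iff e y z).1 (by omega)])
  have hcard : S2.card = (relDescents e' (e' * π')).card := by
    apply Finset.card_bij (fun x _ => c x)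
    · intro x hx
      rw [hS2, Finset.mem_filter_univ] at hx
      obtain ⟨y, hc, h1, h2⟩ := hx
      have hxy : e x < e y := by rw [Fin.lt_def]; omega
      refine mem_relDescents.2 ⟨c y, ?_, ?_⟩
      · obtain ⟨w, hw⟩ := exists_succ_of_lt (hlt hc hxy)
        obtain ⟨z, rfl⟩ := hsurj w
        have h3 : e x < e z := h _ _ (by rw [Fin.lt_def]; omega)
        have h4 : e y ≤ e z := by rw [Fin.le_def]; rw [Fin.lt_def] at h3; omega
        have h5 := h.le h4
        have h6 := hlt hc hxy
        rw [Fin.le_def] at h5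
        rw [Fin.lt_def] at h6
        omega
      · rw [Perm.mul_apply, Perm.mul_apply, ← hπ, ← hπ]
        refine hlt ?_ h2
        rw [hπ, hπ]
        exact π'.injective.ne (Ne.symm hc)
    · intro x hx y hy hxy
      rw [hS2, Finset.mem_filter_univ] at hx hy
      by_contra hne
      wlog hle : e x < e y generalizing x y
      · refine this y hy x hx hxy.symm (Ne.symm hne) ?_
        exact lt_of_le_of_ne (not_lt.1 hle) (e.injective.ne (Ne.symm hne))
      obtain ⟨z, hc, h1, -⟩ := hx
      refine hc (h.fiber_convex (x := x) (y := z) (z := y) ?_ ?_ hxy).symm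
      · rw [Fin.le_def]; omega
      · rw [Fin.le_def]; rw [Fin.lt_def] at hle; omega
    · intro u hu
      obtain ⟨v, h1, h2⟩ := mem_relDescents.1 hu
      have hne : ({x : Fin n | c x = u} : Finset (Fin n)).Nonempty := by
        obtain ⟨x, hx⟩ := hsurj u
        exact ⟨x, by simpa using hx⟩
      obtain ⟨x, hx, hmax⟩ := Finset.exists_max_image _ e hne
      rw [Finset.mem_filter_univ] at hx
      obtain ⟨w, rfl⟩ := hsurj v
      subst hx
      have hxw : e x < e w := h _ _ (by rw [Fin.lt_def]; omega)
      obtain ⟨y, hy⟩ := exists_succ_of_lt hxw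
      have hxy : e x < e y := by rw [Fin.lt_def]; omega
      have hcy : c x ≠ c y := by
        intro hc
        exact (hmax y (by simpa using hc.symm)).not_gt hxy
      have h3 := hlt hcy hxy
      have h4 : e' (c y) ≤ e' (c w) := h.le (by rw [Fin.le_def]; rw [Fin.lt_def] at hxw; omega)
      have hcw : c y = c w := by
        apply (val_eq_iff e' _ _).1
        rw [Fin.le_def] at h4
        rw [Fin.lt_def] at h3
        omega
      refine ⟨x, ?_, rfl⟩
      rw [hS2, Finset.mem_filter_univ]
      refine ⟨y, hcy, hy, h _ _ ?_⟩
      rwa [hπ, hπ, hcw]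
  unfold orderDes relDes fiberDes
  rw [hunion, Finset.card_union_of_disjoint hdisj, hcard]

/-- Sort by block first and by `e` within a block: the order of the blocks is free, and all
comparisons inside blocks survive. -/
theorem exists_compatible (c : Fin n → Fin n') (hfib : ∀ x, c (π x) = π' (c x))
    (e : Perm (Fin n)) (e' : Perm (Fin n')) :
    ∃ g : Perm (Fin n), Compatible c g e' ∧ fiberDes c π g = fiberDes c π e := by
  obtain ⟨g, hg⟩ := exists_order_of_key (fun x => toLex (e' (c x), e x))
  have hsame : ∀ x y, c x = c y → (g x < g y ↔ e x < e y) := by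
    have key : ∀ x y, c x = c y → e x < e y → g x < g y := by
      intro x y hc hxy
      refine hg x y ?_
      rw [Prod.Lex.toLex_lt_toLex]
      exact Or.inr ⟨by rw [hc], hxy⟩
    intro x y hc
    refine ⟨fun hlt => ?_, key x y hc⟩
    by_contra hnot
    rcases lt_or_eq_of_le (not_lt.1 hnot) with h | h
    · exact (key y x hc.symm h).not_gt hlt
    · rw [e.injective h] at hlt
      exact lt_irrefl _ hlt
  refine ⟨g, fun x y hxy => hg x y ?_, ?_⟩
  · rw [Prod.Lex.toLex_lt_toLex]
    exact Or.inl hxy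
  · unfold fiberDes
    congr 1
    ext x
    simp only [Finset.mem_filter_univ]
    refine exists_congr fun y => and_congr_right fun hc => ?_
    rw [hsame x y hc, hsame (π y) (π x) (by rw [hfib, hfib, hc])]

end Contraction

/-! ### An order with a single descent -/

section CycleOrder

variable {n : ℕ}

/-- A chosen point of the cycle of `x`. -/
noncomputable def cycleRep (π : Perm (Fin n)) (x : Fin n) : Fin n :=
  (Quotient.mk (Perm.SameCycle.setoid π) x).out

theorem cycleRep_apply (π : Perm (Fin n)) (x : Fin n) : cycleRep π (π x) = cycleRep π x := by
  unfold cycleRep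
  congr 1
  apply Quotient.sound
  exact Perm.sameCycle_apply_left.2 (Perm.SameCycle.refl π x)

theorem exists_pow_eq_cycleRep (π : Perm (Fin n)) (x : Fin n) :
    ∃ t : ℕ, (π ^ t) x = cycleRep π x := by
  have h : Perm.SameCycle π (cycleRep π x) x :=
    Quotient.exact (s := Perm.SameCycle.setoid π) (Quotient.out_eq _)
  obtain ⟨t, ht⟩ := h.symm.exists_nat_pow_eq
  exact ⟨t, ht⟩

/-- The number of steps from `x` to the chosen point of its cycle. -/
noncomputable def timeToRep (π : Perm (Fin n)) (x : Fin n) : ℕ :=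
  Nat.find (exists_pow_eq_cycleRep π x)

theorem pow_timeToRep (π : Perm (Fin n)) (x : Fin n) :
    (π ^ timeToRep π x) x = cycleRep π x :=
  Nat.find_spec (exists_pow_eq_cycleRep π x)

theorem timeToRep_le {π : Perm (Fin n)} {x : Fin n} {t : ℕ} (h : (π ^ t) x = cycleRep π x) :
    timeToRep π x ≤ t :=
  Nat.find_min' _ h

theorem timeToRep_apply_of_pos {π : Perm (Fin n)} {x : Fin n} (h : 0 < timeToRep π x) :
    timeToRep π (π x) + 1 = timeToRep π x := by
  apply le_antisymm
  · obtain ⟨t, ht⟩ : ∃ t, timeToRep π x = t + 1 := ⟨timeToRep π x - 1, by omega⟩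
    have h1 := pow_timeToRep π x
    rw [ht, pow_succ, Perm.mul_apply, ← cycleRep_apply] at h1
    have := timeToRep_le h1
    omega
  · apply timeToRep_le
    rw [pow_succ, Perm.mul_apply, pow_timeToRep, cycleRep_apply]

theorem timeToRep_apply_of_eq_zero {π : Perm (Fin n)} {x : Fin n} (h : timeToRep π x = 0) :
    timeToRep π (π x) + 1 = Function.minimalPeriod π x := by
  have hx : cycleRep π x = x := by
    have := pow_timeToRep π x
    rw [h, pow_zero, Perm.one_apply] at this
    exact this.symm
  have hper : ∀ t : ℕ, (π ^ t) x = x ↔ Function.IsPeriodicPt π t x := by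
    intro t
    rw [Function.IsPeriodicPt, Function.IsFixedPt, Perm.iterate_eq_pow]
  have hpos : 0 < Function.minimalPeriod π x := by
    apply Function.IsPeriodicPt.minimalPeriod_pos (n := orderOf π) (orderOf_pos π)
    rw [← hper, pow_orderOf_eq_one, Perm.one_apply]
  apply le_antisymm
  · have : timeToRep π (π x) ≤ Function.minimalPeriod π x - 1 := by
      apply timeToRep_le
      rw [cycleRep_apply, hx, ← Perm.mul_apply, ← pow_succ, Nat.sub_add_cancel hpos, hper]
      exact Function.isPeriodicPt_minimalPeriod _ _
    omega
  · apply Function.IsPeriodicPt.minimalPeriod_le (Nat.succ_pos _)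
    rw [← hper, pow_succ, Perm.mul_apply, pow_timeToRep, cycleRep_apply, hx]

theorem minimalPeriod_apply (π : Perm (Fin n)) (x : Fin n) :
    Function.minimalPeriod π (π x) = Function.minimalPeriod π x := by
  refine Function.minimalPeriod_apply (f := π) ?_
  refine ⟨orderOf π, orderOf_pos π, ?_⟩
  rw [Function.IsPeriodicPt, Function.IsFixedPt, Perm.iterate_eq_pow, pow_orderOf_eq_one,
    Perm.one_apply]

theorem eq_of_timeToRep_eq {π : Perm (Fin n)} {x y : Fin n} (h1 : timeToRep π x = timeToRep π y)
    (h2 : cycleRep π x = cycleRep π y) : x = y := by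
  apply (π ^ timeToRep π x).injective
  rw [pow_timeToRep, h2, ← pow_timeToRep π y, h1]

/-- The key by which points are sorted: first by decreasing time to the chosen point of the cycle,
then by decreasing length of the cycle, then by cycle. -/
noncomputable def cycleKey (π : Perm (Fin n)) (x : Fin n) : ℕᵒᵈ ×ₗ ℕᵒᵈ ×ₗ Fin n :=
  toLex (OrderDual.toDual (timeToRep π x),
    toLex (OrderDual.toDual (Function.minimalPeriod π x), cycleRep π x))

theorem cycleKey_lt_iff {π : Perm (Fin n)} {x y : Fin n} : cycleKey π x < cycleKey π y ↔
    timeToRep π y < timeToRep π x ∨ timeToRep π x = timeToRep π y ∧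
      (Function.minimalPeriod π y < Function.minimalPeriod π x ∨
        Function.minimalPeriod π x = Function.minimalPeriod π y ∧
          cycleRep π x < cycleRep π y) := by
  simp [cycleKey, Prod.Lex.toLex_lt_toLex]

theorem cycleKey_injective (π : Perm (Fin n)) : Function.Injective (cycleKey π) := by
  intro x y h
  simp only [cycleKey, EmbeddingLike.apply_eq_iff_eq, Prod.mk.injEq] at h
  exact eq_of_timeToRep_eq h.1 h.2.2

/-- In the order of `cycleKey`, `π` lowers a positive time by one and keeps the tie-breaks. It sends
time 0 to the cycle length minus one, and longer cycles come first on both sides. Hence order can be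
reversed only where the time drops to 0, which happens at most once. -/
theorem exists_orderDes_eq_one {π : Perm (Fin n)} (hπ : π ≠ 1) : ∃ e, orderDes π e = 1 := by
  obtain ⟨e, he⟩ := exists_order_of_key (cycleKey π)
  have he' : ∀ x y, e x < e y → cycleKey π x < cycleKey π y := by
    intro x y hxy
    rcases lt_trichotomy (cycleKey π x) (cycleKey π y) with h | h | h
    · exact h
    · rw [cycleKey_injective π h] at hxy
      exact absurd hxy (lt_irrefl _)
    · exact absurd hxy (he _ _ h).not_gt
  refine ⟨e, le_antisymm ?_ (orderDes_pos hπ e)⟩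
  have hdesc : ∀ x y, (e y : ℕ) = e x + 1 → e (π y) < e (π x) →
      0 < timeToRep π x ∧ timeToRep π y = 0 := by
    intro x y h1 h2
    have h3 := cycleKey_lt_iff.1 (he' x y (by rw [Fin.lt_def]; omega))
    have h4 := cycleKey_lt_iff.1 (he' _ _ h2)
    rw [minimalPeriod_apply, minimalPeriod_apply, cycleRep_apply, cycleRep_apply] at h4
    rcases Nat.eq_zero_or_pos (timeToRep π x) with hx | hx <;>
    rcases Nat.eq_zero_or_pos (timeToRep π y) with hy | hy
    · exfalso
      have := timeToRep_apply_of_eq_zero hx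
      have := timeToRep_apply_of_eq_zero hy
      rw [Fin.lt_def] at h3 h4
      omega
    · exfalso
      omega
    · exact ⟨hx, hy⟩
    · exfalso
      have := timeToRep_apply_of_pos hx
      have := timeToRep_apply_of_pos hy
      rw [Fin.lt_def] at h3 h4
      omega
  unfold orderDes relDes
  rw [Finset.card_le_one]
  intro x1 hx1 x2 hx2
  obtain ⟨y1, h1, h1'⟩ := mem_relDescents.1 hx1
  obtain ⟨y2, h2, h2'⟩ := mem_relDescents.1 hx2
  have d1 := hdesc x1 y1 h1 h1'
  have d2 := hdesc x2 y2 h2 h2'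
  have aux : ∀ x y, timeToRep π y < timeToRep π x → e x < e y := fun x y h =>
    he _ _ (cycleKey_lt_iff.2 (Or.inl h))
  have a1 := aux x2 y1 (by omega)
  have a2 := aux x1 y2 (by omega)
  apply (val_eq_iff e _ _).1
  rw [Fin.lt_def] at a1 a2
  omega

end CycleOrder

/-! ### From a skipped value to a jump, and its contraction -/

section NoGaps

variable {n : ℕ} {π e : Perm (Fin n)} {a b : Fin n} {k ε : ℤ}

theorem abs_orderDes_mul_swap_sub_le (h : Adjacent e a b) :
    |(orderDes π (e * swap a b) : ℤ) - orderDes π e| ≤ 2 := by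
  unfold orderDes
  rw [mul_swap_mul]
  have h1 := relDes_mul_swap_of_adjacent (e := e) (adjacent_mul_inv (π := π) h)
  have h2 := abs_relDes_swap_mul_sub_le (f := e * π * swap (π⁻¹ a) (π⁻¹ b)) h
  rw [abs_le] at h2 ⊢
  rcases orderSign_eq_or (e := e) (f := e * π) (x := π⁻¹ a) (y := π⁻¹ b) with h3 | h3 <;>
  split_ifs at h1 <;> omega

/-- If the number of descents takes values below and above `k` but not `k`, it jumps over `k` at an
exchange of two neighbours. -/
theorem exists_isJump {k : ℕ} (hk : ∀ e, orderDes π e ≠ k) (h1 : ∃ e, orderDes π e < k)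
    (h2 : ∃ e, k < orderDes π e) : ∃ e a b, IsJump π k 1 e a b := by
  obtain ⟨e₁, he₁⟩ := h1
  obtain ⟨e₂, he₂⟩ := h2
  cases n with
  | zero =>
    rw [Subsingleton.elim e₁ e₂] at he₁
    omega
  | succ n =>
    by_contra hno
    -- Without a jump, staying below `k` is preserved by exchanges of neighbours, hence by the whole
    -- group they generate.
    have key : ∀ g : Perm (Fin (n + 1)), ∀ e, orderDes π e < k → orderDes π (g * e) < k := by
      intro g
      have hg : g ∈ Submonoid.closure
          (Set.range fun i : Fin n => swap i.castSucc i.succ) := by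
        rw [Perm.mclosure_swap_castSucc_succ]
        trivial
      induction hg using Submonoid.closure_induction with
      | mem g hg =>
        obtain ⟨i, rfl⟩ := hg
        intro e he
        have hadj : Adjacent e (e⁻¹ i.castSucc) (e⁻¹ i.succ) := by
          left
          simp
        have hsw : swap i.castSucc i.succ * e = e * swap (e⁻¹ i.castSucc) (e⁻¹ i.succ) := by
          rw [swap_mul_eq_mul_swap]
        simp only [hsw]
        by_contra hge
        have h3 := abs_orderDes_mul_swap_sub_le (π := π) hadj
        have h4 := hk (e * swap (e⁻¹ i.castSucc) (e⁻¹ i.succ))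
        rw [abs_le] at h3
        exact hno ⟨e, _, _, Or.inl rfl, hadj, by omega, by omega⟩
      | one => simp
      | mul g h _ _ ihg ihh =>
        intro e he
        rw [mul_assoc]
        exact ihg _ (ihh _ he)
    have := key (e₂ * e₁⁻¹) e₁ he₁
    rw [inv_mul_cancel_right] at this
    omega

/-- `{x, y}` is one of the preimages of `{a, b}` under the powers of `π`. -/
def InPairOrbit (π : Perm (Fin n)) (a b x y : Fin n) : Prop :=
  ∃ j : ℕ, PairEq x y ((π⁻¹ ^ j) a) ((π⁻¹ ^ j) b)

theorem InPairOrbit.symm {x y : Fin n} (h : InPairOrbit π a b x y) : InPairOrbit π a b y x := by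
  obtain ⟨j, h⟩ := h
  refine ⟨j, ?_⟩
  rcases h with ⟨h1, h2⟩ | ⟨h1, h2⟩
  · exact Or.inr ⟨h2, h1⟩
  · exact Or.inl ⟨h2, h1⟩

theorem inPairOrbit_self : InPairOrbit π a b a b := ⟨0, Or.inl ⟨rfl, rfl⟩⟩

theorem InPairOrbit.map_inv {x y : Fin n} (h : InPairOrbit π a b x y) (i : ℕ) :
    InPairOrbit π a b ((π⁻¹ ^ i) x) ((π⁻¹ ^ i) y) := by
  obtain ⟨j, h⟩ := h
  refine ⟨i + j, ?_⟩
  rw [pow_add]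
  exact h.map _

theorem InPairOrbit.map {x y : Fin n} (h : InPairOrbit π a b x y) :
    InPairOrbit π a b (π x) (π y) := by
  have hπ : π⁻¹ ^ (orderOf π - 1) = π := by
    have h1 : π⁻¹ ^ (orderOf π - 1) * π⁻¹ = 1 := by
      rw [← pow_succ, Nat.sub_add_cancel (orderOf_pos π), inv_pow, pow_orderOf_eq_one, inv_one]
    exact mul_inv_eq_one.1 h1
  have := h.map_inv (orderOf π - 1)
  rwa [hπ] at this

theorem IsJump.adjacent_of_inPairOrbit (hk : ∀ e, (orderDes π e : ℤ) ≠ k)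
    (h : IsJump π k ε e a b) {x y : Fin n} (hxy : InPairOrbit π a b x y) : Adjacent e x y := by
  obtain ⟨j, hj⟩ := hxy
  exact hj.adjacent_iff.2 (h.adjacent_iterate hk j)

/-- Two pairs of the orbit are equal or disjoint, so no point has two partners. -/
theorem IsJump.inPairOrbit_unique (hk : ∀ e, (orderDes π e : ℤ) ≠ k)
    (h : IsJump π k ε e a b) {x y z : Fin n} (hy : InPairOrbit π a b x y)
    (hz : InPairOrbit π a b x z) : y = z := by
  have hyx := (h.adjacent_of_inPairOrbit hk hy).ne
  have hzx := (h.adjacent_of_inPairOrbit hk hz).ne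
  obtain ⟨i, hi⟩ := hy
  obtain ⟨j, hj⟩ := hz
  wlog hij : i ≤ j generalizing i j y z
  · exact (this hzx hyx j hj i hi (by omega)).symm
  have h1 := h.pairEq_or_pairDisjoint_iterate hk (j - i)
  have hpow : ∀ c, (π⁻¹ ^ i) ((π⁻¹ ^ (j - i)) c) = (π⁻¹ ^ j) c := by
    intro c
    rw [← Perm.mul_apply, ← pow_add, Nat.add_sub_cancel' hij]
  have h2 : PairEq ((π⁻¹ ^ j) a) ((π⁻¹ ^ j) b) ((π⁻¹ ^ i) a) ((π⁻¹ ^ i) b) ∨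
      PairDisjoint ((π⁻¹ ^ j) a) ((π⁻¹ ^ j) b) ((π⁻¹ ^ i) a) ((π⁻¹ ^ i) b) := by
    rcases h1 with h1 | h1
    · left
      simpa only [hpow] using h1.map (π⁻¹ ^ i)
    · right
      simpa only [hpow] using h1.map (π⁻¹ ^ i)
  unfold PairEq PairDisjoint at *
  grind

/-- Orders that list the pairs of a jump as blocks can be compared with orders of the set of
blocks. -/
theorem IsJump.exists_contraction (hk : ∀ e, (orderDes π e : ℤ) ≠ k) (h : IsJump π k ε e a b) :
    ∃ n' < n, ∃ (c : Fin n → Fin n') (π' e' : Perm (Fin n')), Function.Surjective c ∧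
      (∀ x y, c x = c y ↔ x = y ∨ InPairOrbit π a b x y) ∧ (∀ x, c (π x) = π' (c x)) ∧
      Compatible c e e' ∧ Compatible c (e * swap a b) e' := by
  classical
  let r : Setoid (Fin n) :=
    { r := fun x y => x = y ∨ InPairOrbit π a b x y
      iseqv :=
        { refl := fun x => Or.inl rfl
          symm := fun hxy => hxy.imp Eq.symm InPairOrbit.symm
          trans := by
            rintro x y z (rfl | hxy) (rfl | hyz)
            · exact Or.inl rfl
            · exact Or.inr hyz
            · exact Or.inr hxy
            · exact Or.inl (h.inPairOrbit_unique hk hxy.symm hyz) } }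
  let E : Quotient r ≃ Fin (Fintype.card (Quotient r)) := Fintype.equivFin _
  let c : Fin n → Fin (Fintype.card (Quotient r)) := fun x => E (Quotient.mk r x)
  have hc : ∀ x y, c x = c y ↔ x = y ∨ InPairOrbit π a b x y := fun x y =>
    E.injective.eq_iff.trans Quotient.eq
  have hsurj : Function.Surjective c := E.surjective.comp Quotient.mk_surjective
  have hcπ : ∀ x y, c x = c y → c (π x) = c (π y) := by
    intro x y hxy
    rw [hc] at hxy ⊢
    exact hxy.imp (congrArg π) InPairOrbit.map
  have hcπ' : ∀ x y, c (π x) = c (π y) → c x = c y := by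
    intro x y hxy
    rw [hc] at hxy ⊢
    refine hxy.imp (fun h => π.injective h) fun h => ?_
    simpa using h.map_inv 1
  let s := Function.surjInv hsurj
  have hs : ∀ u, c (s u) = u := Function.surjInv_eq hsurj
  let F : Fin (Fintype.card (Quotient r)) → Fin (Fintype.card (Quotient r)) := fun u => c (π (s u))
  have hF : Function.Injective F := by
    intro u v huv
    rw [← hs u, ← hs v]
    exact hcπ' _ _ huv
  let π' : Perm (Fin (Fintype.card (Quotient r))) :=
    Equiv.ofBijective F (Finite.injective_iff_bijective.1 hF)
  -- Partners are `e`-neighbours, so the order of the blocks does not depend on the chosen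
  -- representatives.
  obtain ⟨e', he'⟩ := exists_order_of_key (fun u => e (s u))
  have hlt : ∀ x y, e' (c x) < e' (c y) → c x ≠ c y ∧ e x < e y := by
    intro x y hxy
    have hne : c x ≠ c y := fun h => by
      rw [h] at hxy
      exact lt_irrefl _ hxy
    refine ⟨hne, ?_⟩
    have hle : e (s (c x)) ≤ e (s (c y)) := by
      by_contra hlt
      exact (he' _ _ (not_le.1 hlt)).not_gt hxy
    have hv : ∀ {u v}, c u ≠ c v → (e u : ℕ) ≠ e v := by
      intro u v huv heq
      exact huv (congrArg c ((val_eq_iff e u v).1 heq))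
    have h1 : (e (s (c x)) : ℕ) ≠ e (s (c y)) := hv (by rwa [hs, hs])
    have h2 : (e (s (c x)) : ℕ) ≠ e y := hv (by rwa [hs])
    have h3 : (e x : ℕ) ≠ e (s (c y)) := hv (by rwa [hs])
    have h4 : (e x : ℕ) ≠ e y := hv hne
    have hnear : ∀ x, (e x : ℕ) = e (s (c x)) ∨ Adjacent e x (s (c x)) := by
      intro x
      rcases (hc x (s (c x))).1 (hs _).symm with h5 | h5
      · exact Or.inl (congrArg (fun z => (e z : ℕ)) h5)
      · exact Or.inr (h.adjacent_of_inPairOrbit hk h5)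
    have h5 := hnear x
    have h6 := hnear y
    unfold Adjacent at h5 h6
    rw [Fin.le_def] at hle
    rw [Fin.lt_def]
    omega
  have hcab : c a = c b := (hc a b).2 (Or.inr inPairOrbit_self)
  refine ⟨Fintype.card (Quotient r), ?_, c, π', e', hsurj, hc, ?_, ?_, ?_⟩
  · have := Fintype.card_lt_of_surjective_not_injective c hsurj
      (fun hinj => h.adjacent.ne (hinj hcab))
    simpa using this
  · intro x
    exact hcπ _ _ (hs (c x)).symm
  · exact fun x y hxy => (hlt x y hxy).2
  · intro x y hxy
    obtain ⟨h1, h2⟩ := hlt x y hxy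
    refine (mul_swap_lt_iff h.adjacent ?_ ?_).2 h2
    · rintro ⟨rfl, rfl⟩
      exact h1 hcab
    · rintro ⟨rfl, rfl⟩
      exact h1 hcab.symm

/-! ### Permutations of four and six points -/

theorem exists_orderDes_eq_of_semiconj {m : ℕ} {t : Fin m → Fin n} (ht : Function.Bijective t)
    {τ : Perm (Fin m)} (h : ∀ i, π (t i) = t (τ i)) (g : Perm (Fin m)) :
    ∃ e, orderDes π e = des (g * τ * g⁻¹) := by
  have hmn : m = n := by simpa using Fintype.card_of_bijective ht
  subst hmn
  let T : Perm (Fin m) := Equiv.ofBijective t ht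
  have hT : π * T = T * τ := Equiv.ext h
  refine ⟨g * T⁻¹, ?_⟩
  rw [← des_conj]
  congr 1
  rw [eq_mul_inv_of_mul_eq hT]
  group

/-- Both `k - 1` and `k + 1` are attained, and attained values lie between `1` and `n - 1`. -/
theorem IsJump.bounds (h : IsJump π k ε e a b) : 2 ≤ k ∧ k + 2 ≤ n := by
  have hπ : π ≠ 1 := by
    rintro rfl
    exact h.preimage_disjoint.1 (by simp)
  have h1 := orderDes_pos hπ e
  have h2 := orderDes_pos hπ (e * swap a b)
  have hn : 0 < n := a.pos
  have h3 : orderDes π e < n := relDes_lt hn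
  have h4 : orderDes π (e * swap a b) < n := relDes_lt hn
  have h5 := h.source
  have h6 := h.target
  rcases h.sign with hε | hε <;> subst hε <;> constructor <;> omega

/-- A permutation of four points, two of which, together with their preimages, fill everything. -/
theorem IsJump.exists_of_four (h : IsJump π k ε e a b)
    (hsurj : ∀ x, x = a ∨ x = b ∨ x = π⁻¹ a ∨ x = π⁻¹ b) (hp : PairEq (π a) (π b) (π⁻¹ a) (π⁻¹ b)) :
    ∃ e, (orderDes π e : ℤ) = k := by
  have hab := h.adjacent.ne
  have hd := h.preimage_disjoint
  have hpq : π⁻¹ a ≠ π⁻¹ b := π⁻¹.injective.ne hab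
  have hp1 : π (π⁻¹ a) = a := by simp
  have hq1 : π (π⁻¹ b) = b := by simp
  obtain ⟨hd1, hd2, hd3, hd4⟩ := hd
  have hb := h.bounds
  generalize π⁻¹ a = p at *
  generalize π⁻¹ b = q at *
  have ht : Function.Bijective ![a, b, p, q] := by
    constructor
    · intro i j hij
      fin_cases i <;> fin_cases j <;> simp_all
    · intro x
      rcases hsurj x with rfl | rfl | rfl | rfl
      exacts [⟨0, rfl⟩, ⟨1, rfl⟩, ⟨2, rfl⟩, ⟨3, rfl⟩]
  have hn : 4 = n := by simpa using Fintype.card_of_bijective ht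
  have hk : k = 2 := by omega
  rcases hp with ⟨h1, h2⟩ | ⟨h1, h2⟩
  -- Here `π` is a product of two transpositions; in the other case it is a four-cycle.
  · let τ : Perm (Fin 4) := ⟨![2, 3, 0, 1], ![2, 3, 0, 1], by decide, by decide⟩
    obtain ⟨e, he⟩ := exists_orderDes_eq_of_semiconj ht (τ := τ)
      (by intro i; fin_cases i; exacts [h1, h2, hp1, hq1])
      ⟨![0, 2, 1, 3], ![0, 2, 1, 3], by decide, by decide⟩
    refine ⟨e, ?_⟩
    rw [he, hk]
    decide
  · let τ : Perm (Fin 4) := ⟨![3, 2, 0, 1], ![2, 3, 1, 0], by decide, by decide⟩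
    obtain ⟨e, he⟩ := exists_orderDes_eq_of_semiconj ht (τ := τ)
      (by intro i; fin_cases i; exacts [h1, h2, hp1, hq1]) 1
    refine ⟨e, ?_⟩
    rw [he, hk]
    decide

theorem exists_des_conj_two_cycles {k : ℤ} (h2 : 2 ≤ k) (h4 : k ≤ 4) :
    ∃ g : Perm (Fin 6), (des (g * ⟨![1, 2, 0, 4, 5, 3], ![2, 0, 1, 5, 3, 4], by decide, by decide⟩
      * g⁻¹) : ℤ) = k := by
  obtain rfl | rfl | rfl : k = 2 ∨ k = 3 ∨ k = 4 := by omega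
  · exact ⟨1, by decide⟩
  · exact ⟨⟨![0, 1, 5, 2, 3, 4], ![0, 1, 3, 4, 5, 2], by decide, by decide⟩, by decide⟩
  · exact ⟨⟨![0, 4, 2, 1, 3, 5], ![0, 3, 2, 4, 1, 5], by decide, by decide⟩, by decide⟩

theorem exists_des_conj_six_cycle {k : ℤ} (h2 : 2 ≤ k) (h4 : k ≤ 4) :
    ∃ g : Perm (Fin 6), (des (g * ⟨![1, 2, 3, 4, 5, 0], ![5, 0, 1, 2, 3, 4], by decide, by decide⟩
      * g⁻¹) : ℤ) = k := by
  obtain rfl | rfl | rfl : k = 2 ∨ k = 3 ∨ k = 4 := by omega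
  · exact ⟨⟨![0, 1, 2, 4, 3, 5], ![0, 1, 2, 4, 3, 5], by decide, by decide⟩, by decide⟩
  · exact ⟨⟨![0, 1, 3, 4, 2, 5], ![0, 1, 4, 2, 3, 5], by decide, by decide⟩, by decide⟩
  · exact ⟨⟨![0, 3, 2, 4, 1, 5], ![0, 4, 2, 1, 3, 5], by decide, by decide⟩, by decide⟩

theorem IsJump.exists_of_six (h : IsJump π k ε e a b)
    (hsurj : ∀ x, x = a ∨ x = b ∨ x = π a ∨ x = π b ∨ x = π⁻¹ a ∨ x = π⁻¹ b)
    (hd' : PairDisjoint (π a) (π b) (π⁻¹ a) (π⁻¹ b)) :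
    ∃ e, (orderDes π e : ℤ) = k := by
  have hab := h.adjacent.ne
  have hd := h.preimage_disjoint
  have hd'' : PairDisjoint a b (π a) (π b) := by simpa using hd.map π
  have hpq : π⁻¹ a ≠ π⁻¹ b := π⁻¹.injective.ne hab
  have hrs : π a ≠ π b := π.injective.ne hab
  have hp1 : π (π⁻¹ a) = a := by simp
  have hq1 : π (π⁻¹ b) = b := by simp
  obtain ⟨hd1, hd2, hd3, hd4⟩ := hd
  obtain ⟨hd5, hd6, hd7, hd8⟩ := hd'
  obtain ⟨hd9, hd10, hd11, hd12⟩ := hd''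
  have hb := h.bounds
  have hinj := π.injective
  generalize π⁻¹ a = p at *
  generalize π⁻¹ b = q at *
  generalize hr : π a = r at *
  generalize hs : π b = s at *
  have himg : ∀ x, x ≠ a → x ≠ b → x ≠ p → x ≠ q → π x = p ∨ π x = q := by
    intro x h1 h2 h3 h4
    rcases hsurj (π x) with h5 | h5 | h5 | h5 | h5 | h5
    · exact absurd (hinj (h5.trans hp1.symm)) h3
    · exact absurd (hinj (h5.trans hq1.symm)) h4
    · exact absurd (hinj (h5.trans hr.symm)) h1
    · exact absurd (hinj (h5.trans hs.symm)) h2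
    · exact Or.inl h5
    · exact Or.inr h5
  have hr1 := himg r hd9.symm hd11.symm hd5 hd6
  have hs1 := himg s hd10.symm hd12.symm hd7 hd8
  have hne : π r ≠ π s := hinj.ne hrs
  -- Either `π` consists of the three-cycles `a r p` and `b s q`, or it is the six-cycle `a r q b s
  -- p`.
  rcases hr1 with hr1 | hr1
  · have hs2 : π s = q := hs1.resolve_left fun h => hne (hr1.trans h.symm)
    have ht : Function.Bijective ![a, r, p, b, s, q] := by
      constructor
      · intro i j hij
        fin_cases i <;> fin_cases j <;> simp_all
      · intro x
        rcases hsurj x with rfl | rfl | rfl | rfl | rfl | rfl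
        exacts [⟨0, rfl⟩, ⟨3, rfl⟩, ⟨1, rfl⟩, ⟨4, rfl⟩, ⟨2, rfl⟩, ⟨5, rfl⟩]
    have hn : 6 = n := by simpa using Fintype.card_of_bijective ht
    obtain ⟨g, hg⟩ := exists_des_conj_two_cycles hb.1 (k := k) (by omega)
    obtain ⟨e, he⟩ := exists_orderDes_eq_of_semiconj ht
      (τ := ⟨![1, 2, 0, 4, 5, 3], ![2, 0, 1, 5, 3, 4], by decide, by decide⟩)
      (by intro i; fin_cases i; exacts [hr, hr1, hp1, hs, hs2, hq1]) g
    exact ⟨e, by rw [he, hg]⟩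
  · have hs2 : π s = p := hs1.resolve_right fun h => hne (hr1.trans h.symm)
    have ht : Function.Bijective ![a, r, q, b, s, p] := by
      constructor
      · intro i j hij
        fin_cases i <;> fin_cases j <;> simp_all
      · intro x
        rcases hsurj x with rfl | rfl | rfl | rfl | rfl | rfl
        exacts [⟨0, rfl⟩, ⟨3, rfl⟩, ⟨1, rfl⟩, ⟨4, rfl⟩, ⟨5, rfl⟩, ⟨2, rfl⟩]
    have hn : 6 = n := by simpa using Fintype.card_of_bijective ht
    obtain ⟨g, hg⟩ := exists_des_conj_six_cycle hb.1 (k := k) (by omega)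
    obtain ⟨e, he⟩ := exists_orderDes_eq_of_semiconj ht
      (τ := ⟨![1, 2, 3, 4, 5, 0], ![5, 0, 1, 2, 3, 4], by decide, by decide⟩)
      (by intro i; fin_cases i; exacts [hr, hr1, hq1, hs, hs2, hp1]) g
    exact ⟨e, by rw [he, hg]⟩

/-! ### The induction and the conclusion -/

/-- The numbers of descents of `π` in all orders have no gaps. -/
theorem exists_orderDes_eq (n : ℕ) : ∀ (π : Perm (Fin n)) (k : ℕ), (∃ e, orderDes π e < k) →
    (∃ e, k < orderDes π e) → ∃ e, orderDes π e = k := by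
  induction n using Nat.strong_induction_on with
  | _ n ih =>
    intro π k h1 h2
    by_contra hno
    push Not at hno
    have hk : ∀ e, (orderDes π e : ℤ) ≠ k := fun e h => hno e (by exact_mod_cast h)
    obtain ⟨e, a, b, h⟩ := exists_isJump hno h1 h2
    obtain ⟨n', hn', c, π', e', hsurj, hc, hcπ, hcomp, hcomp'⟩ := h.exists_contraction hk
    have huniq : ∀ x y z, InPairOrbit π a b x y → InPairOrbit π a b x z → y = z :=
      fun x y z => h.inPairOrbit_unique hk
    have hfib : ∀ x y z, c x = c y → c x = c z → x = y ∨ x = z ∨ y = z := by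
      intro x y z hxy hxz
      rcases (hc x y).1 hxy with hxy | hxy
      · exact Or.inl hxy
      rcases (hc x z).1 hxz with hxz | hxz
      · exact Or.inr (Or.inl hxz)
      exact Or.inr (Or.inr (huniq _ _ _ hxy hxz))
    have hD := orderDes_eq_add_fiberDes hcomp hsurj hfib hcπ
    have hD' := orderDes_eq_add_fiberDes hcomp' hsurj hfib hcπ
    have hsource := h.source
    have htarget := h.target
    -- Keep the inside of the blocks as in the source of the jump; one more descent between blocks
    -- would give `k`. For `hdown`, keep it as in the target, which has two more fibre descents.
    have hup : ∀ e'', orderDes π' e'' ≠ orderDes π' e' + 1 := by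
      intro e'' he''
      obtain ⟨g, hg, hg'⟩ := exists_compatible c hcπ e e''
      apply hno g
      rw [orderDes_eq_add_fiberDes hg hsurj hfib hcπ]
      omega
    have hdown : ∀ e'', orderDes π' e'' + 1 ≠ orderDes π' e' := by
      intro e'' he''
      obtain ⟨g, hg, hg'⟩ := exists_compatible c hcπ (e * swap a b) e''
      apply hno g
      rw [orderDes_eq_add_fiberDes hg hsurj hfib hcπ]
      omega
    have hd := h.preimage_disjoint
    have hmove : π' (c a) ≠ c a := by
      rw [← hcπ]
      intro heq
      rcases (hc _ _).1 heq with h3 | h3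
      · exact hd.1 (by rw [Perm.inv_eq_iff_eq]; exact h3.symm)
      · have h4 := huniq _ _ _ h3.symm inPairOrbit_self
        exact hd.2.2.1 (by rw [Perm.inv_eq_iff_eq]; exact h4.symm)
    have hπ' : π' ≠ 1 := by
      rintro rfl
      exact hmove rfl
    obtain ⟨e₁, he₁⟩ := exists_orderDes_eq_one hπ'
    have hpos := orderDes_pos hπ' e'
    have hall : ∀ u, u = c a ∨ u = π' (c a) ∨ u = π'⁻¹ (c a) := by
      intro u
      by_contra hu
      push Not at hu
      obtain ⟨e₂, he₂⟩ := exists_two_le_orderDes hmove hu.1 hu.2.1 hu.2.2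
      -- Either the count of `e'` is 1, and induction yields the forbidden value 2; or it exceeds 1,
      -- and induction starting from the value 1 yields the forbidden predecessor.
      rcases Nat.lt_or_ge (orderDes π' e') 2 with h3 | h3
      · have hne := hup e₂
        obtain ⟨e₃, he₃⟩ := ih n' hn' π' 2 ⟨e', h3⟩ ⟨e₂, by omega⟩
        exact hup e₃ (by omega)
      · have hne := hdown e₁
        obtain ⟨e₃, he₃⟩ := ih n' hn' π' (orderDes π' e' - 1) ⟨e₁, by omega⟩ ⟨e', by omega⟩
        exact hdown e₃ (by omega)
    have hfiber : ∀ x y z, InPairOrbit π a b y z → c x = c y → x = y ∨ x = z := by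
      intro x y z hyz hxy
      rcases (hc _ _).1 hxy with h3 | h3
      · exact Or.inl h3
      · exact Or.inr (huniq _ _ _ h3.symm hyz)
    have hself : InPairOrbit π a b a b := inPairOrbit_self
    have hinv : InPairOrbit π a b (π⁻¹ a) (π⁻¹ b) := by simpa using hself.map_inv 1
    have hcinv : π'⁻¹ (c a) = c (π⁻¹ a) := by
      rw [Perm.inv_eq_iff_eq, ← hcπ]
      simp
    have hsix : ∀ x, x = a ∨ x = b ∨ x = π a ∨ x = π b ∨ x = π⁻¹ a ∨ x = π⁻¹ b := by
      intro x
      rcases hall (c x) with h3 | h3 | h3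
      · have := hfiber _ _ _ hself h3
        tauto
      · have := hfiber _ _ _ hself.map (h3.trans (hcπ a).symm)
        tauto
      · have := hfiber _ _ _ hinv (h3.trans hcinv)
        tauto
    have hpair : ∀ {x y z w}, InPairOrbit π a b x y → InPairOrbit π a b z w → x = z → y = w := by
      rintro x y z w h3 h4 rfl
      exact huniq _ _ _ h3 h4
    -- The image and preimage pairs coincide when the quotient has two points, and are disjoint when
    -- it has three.
    have hcase : PairEq (π a) (π b) (π⁻¹ a) (π⁻¹ b) ∨ PairDisjoint (π a) (π b) (π⁻¹ a) (π⁻¹ b) := by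
      by_cases h3 : π a = π⁻¹ a
      · exact Or.inl (Or.inl ⟨h3, hpair hself.map hinv h3⟩)
      by_cases h4 : π a = π⁻¹ b
      · exact Or.inl (Or.inr ⟨h4, hpair hself.map hinv.symm h4⟩)
      refine Or.inr ⟨h3, h4, fun h5 => h4 ?_, fun h5 => h3 ?_⟩
      · exact hpair hself.map.symm hinv h5
      · exact hpair hself.map.symm hinv.symm h5
    rcases hcase with hcase | hcase
    · obtain ⟨g, hg⟩ := h.exists_of_four (fun x => by
        have := hsix x
        rcases hcase with ⟨h3, h4⟩ | ⟨h3, h4⟩ <;> rw [h3, h4] at this <;> tauto) hcase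
      exact hk g hg
    · obtain ⟨g, hg⟩ := h.exists_of_six hsix hcase
      exact hk g hg

end NoGaps

theorem theorem2 (n : ℕ) (C : ConjClasses (Equiv.Perm (Fin n))) :
    ∃ M : ℕ, IsGreatest {k : ℕ | ∃ π ∈ C.carrier, des π = k} M ∧
      (C.carrier ≠ {1} → {k : ℕ | ∃ π ∈ C.carrier, des π = k} = Set.Icc 1 M) ∧
      (C.carrier = {1} → {k : ℕ | ∃ π ∈ C.carrier, des π = k} = {0}) := by
  obtain ⟨π, rfl⟩ := C.exists_rep
  have hS : {k : ℕ | ∃ σ ∈ (ConjClasses.mk π).carrier, des σ = k} =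
      {k | ∃ e, orderDes π e = k} := by
    ext k
    simp only [Set.mem_ofPred_eq, ConjClasses.mem_carrier_iff_mk_eq,
      ConjClasses.mk_eq_mk_iff_isConj]
    constructor
    · rintro ⟨σ, hσ, rfl⟩
      obtain ⟨e, rfl⟩ := isConj_iff.1 hσ.symm
      exact ⟨e, (des_conj π e).symm⟩
    · rintro ⟨e, rfl⟩
      exact ⟨e * π * e⁻¹, (isConj_iff.2 ⟨e, rfl⟩).symm, des_conj π e⟩
  have hmem : π ∈ (ConjClasses.mk π).carrier := ConjClasses.mem_carrier_mk
  rw [hS]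
  have hbdd : BddAbove {k | ∃ e, orderDes π e = k} := by
    refine ⟨n, ?_⟩
    rintro k ⟨e, rfl⟩
    exact (Finset.card_le_univ (relDescents e (e * π))).trans (Fintype.card_fin n).le
  have hne : {k | ∃ e, orderDes π e = k}.Nonempty := ⟨_, 1, rfl⟩
  have hM := Nat.sSup_mem hne hbdd
  refine ⟨sSup {k | ∃ e, orderDes π e = k}, ⟨hM, fun k hk => le_csSup hbdd hk⟩, ?_, ?_⟩
  · intro hC
    have hπ : π ≠ 1 := by
      rintro rfl
      apply hC
      ext σ
      simp [ConjClasses.mem_carrier_iff_mk_eq, ConjClasses.mk_eq_mk_iff_isConj]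
    ext k
    constructor
    · rintro ⟨e, rfl⟩
      exact ⟨orderDes_pos hπ e, le_csSup hbdd ⟨e, rfl⟩⟩
    · rintro ⟨h1, h2⟩
      obtain ⟨e₁, he₁⟩ := exists_orderDes_eq_one hπ
      obtain ⟨e₂, he₂⟩ := hM
      rcases Nat.eq_or_lt_of_le h1 with rfl | h1
      · exact ⟨e₁, he₁⟩
      rcases Nat.eq_or_lt_of_le h2 with h2 | h2
      · exact ⟨e₂, he₂.trans h2.symm⟩
      exact exists_orderDes_eq n π k ⟨e₁, by omega⟩ ⟨e₂, by omega⟩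
  · intro hC
    rw [hC, Set.mem_singleton_iff] at hmem
    subst hmem
    ext k
    simp [orderDes_one, eq_comm]
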